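/- Let $\Gamma$ be the set of absolutely continuous functions $\gamma:[0,1]\to[0,1]$ with $\gamma(0)=0$, $\gamma(1)=1$ and $\dot\gamma\ge 0$ a.e. on $[0,1]$, and let $\Gamma_0=\{\gamma\in\Gamma:\dot\gamma>0 \text{ a.e. on } [0,1]\}$. For a real-valued $q\in L^2[0,1]$ and $\gamma\in\Gamma$ put $(q,\gamma)=(q\circ\gamma)\sqrt{\dot\gamma}$, which is an element of $L^2[0,1]$, and let $[q]_{\Gamma_0}=\{(q,\gamma):\gamma\in\Gamma_0\}$ and $[q]_{\Gamma}=\{(q,\gamma):\gamma\in\Gamma\}$ be the orbits of $q$, where functions equal a.e. on $[0,1]$ are identified. Let $q\in L^2[0,1]$ be such that $q(t)\neq 0$ for almost every $t\in[0,1]$. Then $$\operatorname{cl}\big([q]_{\Gamma_0}\big)=[q]_{\Gamma},$$ where $\operatorname{cl}$ denotes the closure in the $L^2[0,1]$ norm. -/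

import Mathlib

open MeasureTheory Set

namespace Warp

/-- Lebesgue measure on the unit interval `[0, 1]`. -/
noncomputable def unitMeasure : Measure ℝ := volume.restrict (Icc (0 : ℝ) 1)

/-- The real Hilbert space `L²[0, 1]` (classes of functions modulo a.e. equality, `L²` norm). -/
noncomputable abbrev L2 : Type := Lp ℝ 2 unitMeasure

/-- The semigroup `Γ` of warping functions: absolutely continuous `γ : [0, 1] → [0, 1]` with
`γ' ≥ 0` a.e., `γ 0 = 0` and `γ 1 = 1`. Such a function is represented by any map `ℝ → ℝ` that
restricts to it; the values outside `[0, 1]` play no role, since `deriv γ t` at an interior point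
depends only on the restriction. Absolute continuity makes `γ` differentiable a.e. on `[0, 1]`. -/
def warpings : Set (ℝ → ℝ) :=
  {γ | MapsTo γ (Icc 0 1) (Icc 0 1) ∧ AbsolutelyContinuousOnInterval γ 0 1 ∧
    (∀ᵐ t ∂unitMeasure, 0 ≤ deriv γ t) ∧ γ 0 = 0 ∧ γ 1 = 1}

/-- The group `Γ₀` of invertible warping functions: those `γ ∈ Γ` with `γ' > 0` a.e. -/
def invertibleWarpings : Set (ℝ → ℝ) :=
  {γ | γ ∈ warpings ∧ ∀ᵐ t ∂unitMeasure, 0 < deriv γ t}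

/-- The action `(q, γ) = (q ∘ γ) √γ'`. -/
noncomputable def act (q γ : ℝ → ℝ) : ℝ → ℝ := fun t => q (γ t) * √(deriv γ t)

/-- The orbit of `q` under a set `G` of warping functions: all elements of `L²[0, 1]` that are a.e.
equal to `(q, γ)` for some `γ ∈ G`. -/
def orbit (G : Set (ℝ → ℝ)) (q : ℝ → ℝ) : Set L2 :=
  {p | ∃ γ ∈ G, p =ᵐ[unitMeasure] act q γ}

end Warp

namespace Warp

open Filter Topology
open scoped ENNReal

/-! A warping pushes `γ' dt` forward to Lebesgue measure, so the action is isometric on `L²`. For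
density, `γ` is approximated by `(1 - c) γ + c t`, which lies in `Γ₀`; by isometry `q` may be
replaced by a bounded continuous function, for which dominated convergence applies.

For closedness, let `(q, γₙ) → r`, `F x = ∫₀ˣ q²` and `G t = ∫₀ᵗ r²`. Change of variables gives `F
(γₙ t) → G t`. As `q ≠ 0` a.e., `F` is strictly increasing, so `γₙ → δ = F⁻¹ ∘ G` pointwise, and `δ`
is absolutely continuous because Lebesgue measure is absolutely continuous with respect to `q² dt`.
Squares lose the sign of `r`; repeating the computation with `x |x|`, which is injective, gives `r =
(q, δ)` a.e. -/

instance : IsFiniteMeasure unitMeasure := by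
  unfold unitMeasure
  infer_instance

instance : unitMeasure.WeaklyRegular := by
  unfold unitMeasure
  infer_instance

theorem ae_mem_unitInterval : ∀ᵐ t ∂unitMeasure, t ∈ Icc (0 : ℝ) 1 :=
  ae_restrict_mem measurableSet_Icc

theorem ae_mem_Ioo : ∀ᵐ t ∂unitMeasure, t ∈ Ioo (0 : ℝ) 1 := by
  have h : unitMeasure = volume.restrict (Ioo (0 : ℝ) 1) := restrict_Ioo_eq_restrict_Icc.symm
  rw [h]
  exact ae_restrict_mem measurableSet_Ioo

theorem restrict_unitMeasure_Icc {a b : ℝ} (ha : 0 ≤ a) (hb : b ≤ 1) :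
    unitMeasure.restrict (Icc a b) = volume.restrict (Icc a b) := by
  rw [unitMeasure, Measure.restrict_restrict' measurableSet_Icc,
    inter_eq_left.2 (Icc_subset_Icc ha hb)]

theorem unitMeasure_Iic (x : ℝ) : unitMeasure (Iic x) = ENNReal.ofReal (min x 1) := by
  rw [unitMeasure, Measure.restrict_apply' measurableSet_Icc]
  have : Iic x ∩ Icc (0 : ℝ) 1 = Icc 0 (min x 1) := by
    ext t
    simp only [mem_inter_iff, mem_Iic, mem_Icc, le_min_iff]
    tauto
  rw [this, Real.volume_Icc, sub_zero]

theorem intervalIntegral_eq_setIntegral_unitMeasure (f : ℝ → ℝ) {t : ℝ} (ht : t ∈ Icc (0 : ℝ) 1) :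
    ∫ s in (0 : ℝ)..t, f s = ∫ s in Icc 0 t, f s ∂unitMeasure := by
  rw [restrict_unitMeasure_Icc le_rfl ht.2, intervalIntegral.integral_of_le ht.1,
    integral_Icc_eq_integral_Ioc]

theorem intervalIntegrable_of_integrable {f : ℝ → ℝ} (hf : Integrable f unitMeasure) :
    IntervalIntegrable f volume 0 1 :=
  (intervalIntegrable_iff_integrableOn_Icc_of_le zero_le_one).2 hf

/-- Integrable functions with the same primitive agree almost everywhere. -/
theorem ae_eq_of_forall_setIntegral_Icc_eq {f g : ℝ → ℝ} (hf : Integrable f unitMeasure)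
    (hg : Integrable g unitMeasure)
    (h : ∀ t ∈ Icc (0 : ℝ) 1,
      ∫ s in Icc 0 t, f s ∂unitMeasure = ∫ s in Icc 0 t, g s ∂unitMeasure) :
    f =ᵐ[unitMeasure] g := by
  have key : ∀ {u : ℝ → ℝ}, Integrable u unitMeasure →
      ∀ᵐ t ∂unitMeasure, HasDerivAt (fun t => ∫ s in (0 : ℝ)..t, u s) (u t) t := by
    intro u hu
    filter_upwards [ae_restrict_of_ae (intervalIntegrable_of_integrable hu).ae_hasDerivAt_integral,
      ae_mem_unitInterval] with t ht ht'
    rw [uIcc_of_le zero_le_one] at ht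
    exact ht ht' 0 (by simp)
  filter_upwards [key hf, key hg, ae_mem_Ioo] with t h1 h2 ht
  refine h1.unique (h2.congr_of_eventuallyEq ?_)
  filter_upwards [Ioo_mem_nhds ht.1 ht.2] with s hs
  have hs' := Ioo_subset_Icc_self hs
  rw [intervalIntegral_eq_setIntegral_unitMeasure _ hs',
    intervalIntegral_eq_setIntegral_unitMeasure _ hs', h s hs']

/-! ### Change of variables and the isometric action -/

section Warping

variable {γ : ℝ → ℝ}

theorem setIntegral_deriv (h : γ ∈ warpings) {a b : ℝ} (ha : 0 ≤ a) (hab : a ≤ b) (hb : b ≤ 1) :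
    ∫ t in Icc a b, deriv γ t ∂unitMeasure = γ b - γ a := by
  rw [restrict_unitMeasure_Icc ha hb, integral_Icc_eq_integral_Ioc,
    ← intervalIntegral.integral_of_le hab]
  refine (h.2.1.mono ?_).integral_deriv_eq_sub
  rw [uIcc_of_le hab, uIcc_of_le zero_le_one]
  exact Icc_subset_Icc ha hb

theorem monotoneOn (h : γ ∈ warpings) : MonotoneOn γ (Icc 0 1) := by
  intro a ha b hb hab
  have h1 := setIntegral_deriv h ha.1 hab hb.2
  have h2 : 0 ≤ ∫ t in Icc a b, deriv γ t ∂unitMeasure :=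
    integral_nonneg_of_ae (ae_restrict_of_ae h.2.2.1)
  linarith

theorem continuousOn (h : γ ∈ warpings) : ContinuousOn γ (Icc 0 1) := by
  simpa [uIcc_of_le zero_le_one] using h.2.1.continuousOn

theorem aemeasurable (h : γ ∈ warpings) : AEMeasurable γ unitMeasure :=
  (continuousOn h).aemeasurable measurableSet_Icc

theorem integrable_deriv (h : γ ∈ warpings) : Integrable (deriv γ) unitMeasure :=
  (intervalIntegrable_iff_integrableOn_Icc_of_le zero_le_one).1 h.2.1.intervalIntegrable_deriv

/-- The measure on `[0, 1]` whose density is the derivative of `γ`. -/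
noncomputable def derivMeasure (γ : ℝ → ℝ) : Measure ℝ :=
  unitMeasure.withDensity fun t => ENNReal.ofReal (deriv γ t)

theorem measurable_ofReal_deriv (γ : ℝ → ℝ) : Measurable fun t => ENNReal.ofReal (deriv γ t) :=
  (measurable_deriv γ).ennreal_ofReal

theorem derivMeasure_absolutelyContinuous (γ : ℝ → ℝ) : derivMeasure γ ≪ unitMeasure :=
  withDensity_absolutelyContinuous _ _

theorem derivMeasure_Icc (h : γ ∈ warpings) {s : ℝ} (hs : s ∈ Icc (0 : ℝ) 1) :
    derivMeasure γ (Icc 0 s) = ENNReal.ofReal (γ s) := by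
  rw [derivMeasure, withDensity_apply' _ _,
    ← ofReal_integral_eq_lintegral_ofReal (integrable_deriv h).integrableOn
      (ae_restrict_of_ae h.2.2.1), setIntegral_deriv h le_rfl hs.1 hs.2, h.2.2.2.1, sub_zero]

theorem derivMeasure_inter (γ : ℝ → ℝ) (s : Set ℝ) :
    derivMeasure γ s = derivMeasure γ (s ∩ Icc 0 1) := by
  refine measure_congr ?_
  filter_upwards [(derivMeasure_absolutelyContinuous γ).ae_le ae_mem_unitInterval] with t ht
  exact propext ⟨fun h => ⟨h, ht⟩, fun h => h.1⟩

instance (γ : ℝ → ℝ) : SFinite (derivMeasure γ) := by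
  unfold derivMeasure
  infer_instance

/-- A warping function pushes the measure with density `γ'` forward to Lebesgue measure. -/
theorem map_derivMeasure (h : γ ∈ warpings) : (derivMeasure γ).map γ = unitMeasure := by
  symm
  refine Measure.ext_of_Iic _ _ fun x => ?_
  rw [Measure.map_apply_of_aemeasurable
    ((aemeasurable h).mono_ac (derivMeasure_absolutelyContinuous γ)) measurableSet_Iic,
    unitMeasure_Iic, derivMeasure_inter]
  obtain ⟨hm, -, -, h0, h1⟩ := id h
  rcases lt_or_ge x 0 with hx | hx
  · have : γ ⁻¹' Iic x ∩ Icc 0 1 = ∅ := by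
      ext t
      simp only [mem_inter_iff, mem_preimage, mem_Iic, mem_empty_iff_false, iff_false]
      rintro ⟨h1, h2⟩
      linarith [(hm h2).1]
    rw [this, measure_empty, ENNReal.ofReal_of_nonpos (min_le_of_left_le hx.le)]
  · have hcomp : IsCompact (Icc 0 1 ∩ γ ⁻¹' Iic x) :=
      isCompact_Icc.of_isClosed_subset
        ((continuousOn h).preimage_isClosed_of_isClosed isClosed_Icc isClosed_Iic) inter_subset_left
    -- Taking the last point with `γ ≤ x` accounts for plateaus of `γ`.
    obtain ⟨s, ⟨hs, hsx⟩, hmax⟩ := hcomp.exists_isGreatest ⟨0, by simp, by simpa [h0] using hx⟩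
    have hset : γ ⁻¹' Iic x ∩ Icc 0 1 = Icc 0 s := by
      ext t
      constructor
      · rintro ⟨h1, h2⟩
        exact ⟨h2.1, hmax ⟨h2, h1⟩⟩
      · intro ht
        have ht' : t ∈ Icc (0 : ℝ) 1 := ⟨ht.1, ht.2.trans hs.2⟩
        exact ⟨(monotoneOn h ht' hs ht.2).trans hsx, ht'⟩
    have hsx' : γ s = min x 1 := by
      refine le_antisymm (le_min hsx (hm hs).2) (le_of_not_gt fun hlt => ?_)
      obtain ⟨u, hu, hu'⟩ := intermediate_value_Icc hs.2
        ((continuousOn h).mono (Icc_subset_Icc_left hs.1))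
        (show min x 1 ∈ Icc (γ s) (γ 1) from ⟨hlt.le, by simp [h1]⟩)
      have : u ≤ s := hmax ⟨⟨hs.1.trans hu.1, hu.2⟩, by simp [hu']⟩
      rw [le_antisymm this hu.1] at hu'
      exact hlt.ne hu'
    rw [hset, derivMeasure_Icc h hs, hsx']

theorem aemeasurable_derivMeasure (h : γ ∈ warpings) : AEMeasurable γ (derivMeasure γ) :=
  (aemeasurable h).mono_ac (derivMeasure_absolutelyContinuous γ)

theorem lintegral_comp_mul_deriv (h : γ ∈ warpings) {u : ℝ → ℝ≥0∞} (hu : AEMeasurable u unitMeasure) :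
    ∫⁻ t, ENNReal.ofReal (deriv γ t) * u (γ t) ∂unitMeasure = ∫⁻ t, u t ∂unitMeasure := by
  rw [← map_derivMeasure h] at hu
  conv_rhs => rw [← map_derivMeasure h]
  rw [lintegral_map' hu (aemeasurable_derivMeasure h), derivMeasure,
    lintegral_withDensity_eq_lintegral_mul_non_measurable₀ _
      (measurable_ofReal_deriv γ).aemeasurable (by simp)]
  rfl

theorem setIntegral_comp_mul_deriv (h : γ ∈ warpings) {u : ℝ → ℝ} (hu : Integrable u unitMeasure)
    {t : ℝ} (ht : t ∈ Icc (0 : ℝ) 1) :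
    ∫ s in Icc 0 t, deriv γ s * u (γ s) ∂unitMeasure = ∫ x in Icc 0 (γ t), u x ∂unitMeasure := by
  have hγ := aemeasurable_derivMeasure h
  have hu' := hu.1
  conv_rhs => rw [← map_derivMeasure h]
  rw [← map_derivMeasure h] at hu'
  have hpre : NullMeasurableSet (γ ⁻¹' Icc 0 (γ t)) (derivMeasure γ) :=
    hγ.nullMeasurable measurableSet_Icc
  have hmt := h.1 ht
  -- The preimage may exceed `[0, t]` by a plateau of `γ`, which carries no `γ' dt` mass: both sets
  -- have mass `γ t`.
  have hae : Icc 0 t =ᵐ[derivMeasure γ] γ ⁻¹' Icc 0 (γ t) := by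
    have hsub : Icc 0 t ⊆ γ ⁻¹' Icc 0 (γ t) := fun s hs =>
      have hs' : s ∈ Icc (0 : ℝ) 1 := ⟨hs.1, hs.2.trans ht.2⟩
      ⟨(h.1 hs').1, monotoneOn h hs' ht hs.2⟩
    have heq : derivMeasure γ (γ ⁻¹' Icc 0 (γ t)) = ENNReal.ofReal (γ t) := by
      rw [← Measure.map_apply_of_aemeasurable hγ measurableSet_Icc, map_derivMeasure h, unitMeasure,
        Measure.restrict_apply' measurableSet_Icc, inter_eq_left.2 (Icc_subset_Icc le_rfl hmt.2),
        Real.volume_Icc, sub_zero]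
    refine ae_eq_of_subset_of_measure_ge hsub ?_ measurableSet_Icc.nullMeasurableSet ?_
    · rw [heq, derivMeasure_Icc h ht]
    · rw [heq]
      exact ENNReal.ofReal_ne_top
  rw [setIntegral_map measurableSet_Icc hu' hγ, ← setIntegral_congr_set hae, derivMeasure,
    setIntegral_withDensity_eq_setIntegral_toReal_smul' _ (measurable_ofReal_deriv γ) (by simp)]
  refine integral_congr_ae (ae_restrict_of_ae ?_)
  filter_upwards [h.2.2.1] with s hs
  simp [ENNReal.toReal_ofReal hs]

/-- The action does not depend on the choice of a representative. -/
theorem act_congr_ae (h : γ ∈ warpings) {q r : ℝ → ℝ} (hqr : q =ᵐ[unitMeasure] r) :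
    act q γ =ᵐ[unitMeasure] act r γ := by
  rw [← map_derivMeasure h] at hqr
  have := ae_of_ae_map (aemeasurable_derivMeasure h) hqr
  rw [derivMeasure, ae_withDensity_iff (measurable_ofReal_deriv γ)] at this
  filter_upwards [this] with t ht
  -- Where `γ' = 0`, `γ` may map a set of positive measure into a null set, but there both sides
  -- vanish.
  by_cases h0 : 0 < deriv γ t
  · simp [act, ht (by simpa using h0)]
  · simp [act, Real.sqrt_eq_zero_of_nonpos (not_lt.1 h0)]

theorem aestronglyMeasurable_act (h : γ ∈ warpings) {q : ℝ → ℝ}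
    (hq : AEStronglyMeasurable q unitMeasure) : AEStronglyMeasurable (act q γ) unitMeasure := by
  refine AEStronglyMeasurable.congr ?_ (act_congr_ae h hq.ae_eq_mk).symm
  refine AEMeasurable.aestronglyMeasurable ?_
  exact (hq.stronglyMeasurable_mk.measurable.comp_aemeasurable (aemeasurable h)).mul
    (measurable_deriv γ).sqrt.aemeasurable

/-- The action is isometric. -/
theorem eLpNorm_act (h : γ ∈ warpings) {q : ℝ → ℝ} (hq : AEStronglyMeasurable q unitMeasure) :
    eLpNorm (act q γ) 2 unitMeasure = eLpNorm q 2 unitMeasure := by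
  rw [eLpNorm_eq_lintegral_rpow_enorm_toReal two_ne_zero ENNReal.ofNat_ne_top,
    eLpNorm_eq_lintegral_rpow_enorm_toReal two_ne_zero ENNReal.ofNat_ne_top,
    ← lintegral_comp_mul_deriv h (hq.aemeasurable.enorm.pow_const _)]
  congr 1
  refine lintegral_congr_ae ?_
  filter_upwards [h.2.2.1] with t ht
  simp only [act, enorm_mul, ENNReal.toReal_ofNat, ENNReal.rpow_ofNat, mul_pow]
  rw [mul_comm, Real.enorm_of_nonneg (Real.sqrt_nonneg _), ← ENNReal.ofReal_pow (Real.sqrt_nonneg _),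
    Real.sq_sqrt ht]

theorem memLp_act (h : γ ∈ warpings) {q : ℝ → ℝ} (hq : MemLp q 2 unitMeasure) :
    MemLp (act q γ) 2 unitMeasure :=
  ⟨aestronglyMeasurable_act h hq.1, by rw [eLpNorm_act h hq.1]; exact hq.2⟩

theorem act_sub (q r γ : ℝ → ℝ) : act (q - r) γ = act q γ - act r γ := by
  ext t
  simp [act, sub_mul]

end Warping

/-! ### Density of the `Γ₀`-orbit in the `Γ`-orbit -/

section Density

variable {γ : ℝ → ℝ}

/-- The convex combination of a warping function with the identity. -/
def blend (γ : ℝ → ℝ) (c : ℝ) : ℝ → ℝ := fun t => (1 - c) * γ t + c * t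

/-- A single null set serves all `c`, so pointwise limits along a sequence of `c` can be taken off
it. -/
theorem ae_deriv_blend (h : γ ∈ warpings) :
    ∀ᵐ t ∂unitMeasure, ∀ c, deriv (blend γ c) t = (1 - c) * deriv γ t + c := by
  filter_upwards [ae_restrict_of_ae h.2.1.ae_differentiableAt, ae_mem_unitInterval] with t ht ht' c
  rw [uIcc_of_le zero_le_one] at ht
  have := ((ht ht').hasDerivAt.const_mul (1 - c)).add ((hasDerivAt_id t).const_mul c)
  rw [mul_one] at this
  exact this.deriv

theorem blend_mem_invertibleWarpings (h : γ ∈ warpings) {c : ℝ} (hc : 0 < c) (hc1 : c ≤ 1) :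
    blend γ c ∈ invertibleWarpings := by
  have hpos : ∀ᵐ t ∂unitMeasure, 0 < deriv (blend γ c) t := by
    filter_upwards [ae_deriv_blend h, h.2.2.1] with t ht h0
    rw [ht]
    have := mul_nonneg (sub_nonneg.2 hc1) h0
    linarith
  refine ⟨⟨fun t ht => ?_, ?_, hpos.mono fun t => le_of_lt, by simp [blend, h.2.2.2.1],
    by simp [blend, h.2.2.2.2]⟩, hpos⟩
  · obtain ⟨h0, h1⟩ := h.1 ht
    have := sub_nonneg.2 hc1
    constructor
    · exact add_nonneg (mul_nonneg this h0) (mul_nonneg hc.le ht.1)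
    · simp only [blend]
      nlinarith [ht.2]
  · have hid : AbsolutelyContinuousOnInterval (fun t : ℝ => t) 0 1 := by
      rw [absolutelyContinuousOnInterval_iff]
      exact fun ε hε => ⟨ε, hε, fun _ _ h => h⟩
    exact (h.2.1.const_mul (1 - c)).add (hid.const_mul c)

theorem sq_sub_mul_sqrt_le {x y a b M : ℝ} (hx : |x| ≤ M) (hy : |y| ≤ M) (ha : 0 ≤ a)
    (hb : 0 ≤ b) : (x * √a - y * √b) ^ 2 ≤ 2 * M ^ 2 * (a + b) := by
  have hx2 : x ^ 2 ≤ M ^ 2 := sq_le_sq' (abs_le.1 hx).1 (abs_le.1 hx).2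
  have hy2 : y ^ 2 ≤ M ^ 2 := sq_le_sq' (abs_le.1 hy).1 (abs_le.1 hy).2
  have h1 : (x * √a) ^ 2 ≤ M ^ 2 * a := by
    rw [mul_pow, Real.sq_sqrt ha]
    exact mul_le_mul_of_nonneg_right hx2 ha
  have h2 : (y * √b) ^ 2 ≤ M ^ 2 * b := by
    rw [mul_pow, Real.sq_sqrt hb]
    exact mul_le_mul_of_nonneg_right hy2 hb
  nlinarith [sq_nonneg (x * √a + y * √b)]

/-- The action of the blends on a bounded continuous function converges in `L²`. -/
theorem tendsto_eLpNorm_act_blend (h : γ ∈ warpings) (g : BoundedContinuousFunction ℝ ℝ)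
    {c : ℕ → ℝ} (hc0 : ∀ n, 0 < c n) (hc1 : ∀ n, c n ≤ 1) (hclim : Tendsto c atTop (𝓝 0)) :
    Tendsto (fun n => eLpNorm (act g (blend γ (c n)) - act g γ) 2 unitMeasure) atTop (𝓝 0) := by
  have hg : AEStronglyMeasurable g unitMeasure := g.continuous.aestronglyMeasurable
  have hlin : Tendsto (fun n => ∫⁻ t, ‖(act g (blend γ (c n)) - act g γ) t‖ₑ ^ (2 : ℝ) ∂unitMeasure)
      atTop (𝓝 (∫⁻ _, 0 ∂unitMeasure)) := by
    refine tendsto_lintegral_of_dominated_convergence'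
      -- The bound `2 M² (a + b)` with `M = ‖g‖`, `b = γ'` and `a = (1 - c) γ' + c ≤ γ' + 1`.
      (fun t => ENNReal.ofReal (2 * ‖g‖ ^ 2 * (2 * deriv γ t + 1))) (fun n => ?_) (fun n => ?_) ?_ ?_
    · exact ((aestronglyMeasurable_act (blend_mem_invertibleWarpings h (hc0 n) (hc1 n)).1 hg).sub
        (aestronglyMeasurable_act h hg)).aemeasurable.enorm.pow_const _
    · filter_upwards [ae_deriv_blend h, h.2.2.1] with t ht h0
      have hd : 0 ≤ (1 - c n) * deriv γ t + c n :=
        add_nonneg (mul_nonneg (sub_nonneg.2 (hc1 n)) h0) (hc0 n).le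
      have hle := sq_sub_mul_sqrt_le (g.norm_coe_le_norm (blend γ (c n) t))
        (g.norm_coe_le_norm (γ t)) hd h0
      rw [ENNReal.rpow_ofNat, ← ofReal_norm, ← ENNReal.ofReal_pow (norm_nonneg _),
        Real.norm_eq_abs, sq_abs]
      refine ENNReal.ofReal_le_ofReal ?_
      simp only [Pi.sub_apply, act, ht]
      refine hle.trans (mul_le_mul_of_nonneg_left ?_ (by positivity))
      nlinarith [mul_nonneg (hc0 n).le h0, hc1 n]
    · have hi : Integrable (fun t => 2 * ‖g‖ ^ 2 * (2 * deriv γ t + 1)) unitMeasure :=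
        (((integrable_deriv h).const_mul 2).add (integrable_const 1)).const_mul _
      exact hi.lintegral_lt_top.ne
    · filter_upwards [ae_deriv_blend h] with t ht
      have h1 : Tendsto (fun n => blend γ (c n) t) atTop (𝓝 (γ t)) := by
        have := ((tendsto_const_nhds (x := (1 : ℝ))).sub hclim).mul_const (γ t)
        simpa [blend] using this.add (hclim.mul_const t)
      have h2 : Tendsto (fun n => deriv (blend γ (c n)) t) atTop (𝓝 (deriv γ t)) := by
        simp only [ht]
        have := ((tendsto_const_nhds (x := (1 : ℝ))).sub hclim).mul_const (deriv γ t)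
        simpa using this.add hclim
      have h3 : Tendsto (fun n => (act g (blend γ (c n)) - act g γ) t) atTop (𝓝 0) := by
        have := (((g.continuous.tendsto _).comp h1).mul h2.sqrt).sub_const (act g γ t)
        simpa [act] using this
      simpa using (h3.enorm).ennrpow_const 2
  simp only [eLpNorm_eq_lintegral_rpow_enorm_toReal two_ne_zero ENNReal.ofNat_ne_top,
    ENNReal.toReal_ofNat]
  simpa using hlin.ennrpow_const (1 / 2)

theorem orbit_warpings_subset_closure {q : ℝ → ℝ} (hq : MemLp q 2 unitMeasure) :
    orbit warpings q ⊆ closure (orbit invertibleWarpings q) := by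
  rintro p ⟨γ, hγ, hp⟩
  refine EMetric.mem_closure_iff.2 fun ε hε => ?_
  -- Two thirds pay for replacing `q` by `g` under `γ` and under its blend, the last for moving from
  -- `γ` to the blend.
  have hε3 : ε / 3 ≠ 0 := (ENNReal.div_pos hε.ne' (by norm_num)).ne'
  obtain ⟨g, hg, hgm⟩ := hq.exists_boundedContinuous_eLpNorm_sub_le ENNReal.ofNat_ne_top hε3
  have hc0 : ∀ n : ℕ, 0 < 1 / ((n : ℝ) + 1) := fun n => Nat.one_div_pos_of_nat
  have hc1 : ∀ n : ℕ, 1 / ((n : ℝ) + 1) ≤ 1 := fun n => by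
    simpa using Nat.one_div_le_one_div (α := ℝ) (Nat.zero_le n)
  obtain ⟨n, hn⟩ := ((tendsto_eLpNorm_act_blend hγ g hc0 hc1
    tendsto_one_div_add_atTop_nhds_zero_nat).eventually_lt_const hε3.bot_lt).exists
  have hγn := blend_mem_invertibleWarpings hγ (hc0 n) (hc1 n)
  set δ := blend γ (1 / ((n : ℝ) + 1))
  have hm := memLp_act hγn.1 hq
  refine ⟨hm.toLp _, ⟨δ, hγn, hm.coeFn_toLp⟩, ?_⟩
  have hqg := hq.1.sub hgm.1
  have hdecomp : (p : ℝ → ℝ) - (hm.toLp _ : ℝ → ℝ) =ᵐ[unitMeasure]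
      act (q - g) γ - (act g δ - act g γ) - act (q - g) δ := by
    filter_upwards [hp, hm.coeFn_toLp] with t h1 h2
    simp only [Pi.sub_apply, h1, h2, act_sub]
    ring
  have m1 := aestronglyMeasurable_act hγ hqg
  have m2 := (aestronglyMeasurable_act hγn.1 hgm.1).sub (aestronglyMeasurable_act hγ hgm.1)
  have m3 := aestronglyMeasurable_act hγn.1 hqg
  rw [Lp.edist_def, eLpNorm_congr_ae hdecomp]
  have e1 := (eLpNorm_act hγ hqg).trans_le hg
  have e3 := (eLpNorm_act hγn.1 hqg).trans_le hg
  calc _ ≤ eLpNorm (act (q - g) γ) 2 unitMeasure + eLpNorm (act g δ - act g γ) 2 unitMeasure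
        + eLpNorm (act (q - g) δ) 2 unitMeasure :=
        (eLpNorm_sub_le (m1.sub m2) m3 one_le_two).trans
          (add_le_add_left (eLpNorm_sub_le m1 m2 one_le_two) _)
    _ < ε / 3 + ε / 3 + ε / 3 := by
        have f1 : eLpNorm (act (q - g) γ) 2 unitMeasure ≠ ∞ := (memLp_act hγ (hq.sub hgm)).2.ne
        have f3 : eLpNorm (act (q - g) δ) 2 unitMeasure ≠ ∞ := (memLp_act hγn.1 (hq.sub hgm)).2.ne
        exact ENNReal.add_lt_add_of_lt_of_le f3 (ENNReal.add_lt_add_of_le_of_lt f1 e1 hn) e3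
    _ = ε := ENNReal.add_thirds ε

end Density

/-! ### Functionals that turn the action into a change of variables -/

section Quadratic

/-- A continuous function `Φ` such that `Φ (x √a) = a Φ x`, with the Lipschitz estimate satisfied
by `x ^ 2` and `x |x|`. -/
structure IsQuadratic (Φ : ℝ → ℝ) : Prop where
  continuous : Continuous Φ
  map_mul_sqrt : ∀ x a, 0 ≤ a → Φ (x * √a) = a * Φ x
  abs_sub_le : ∀ x y, |Φ x - Φ y| ≤ |x - y| * (|x| + |y|)

theorem isQuadratic_sq : IsQuadratic fun x => x ^ 2 where
  continuous := by fun_prop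
  map_mul_sqrt x a ha := by rw [mul_pow, Real.sq_sqrt ha, mul_comm]
  abs_sub_le x y := by
    rw [sq_sub_sq, abs_mul, mul_comm]
    exact mul_le_mul_of_nonneg_left (abs_add_le x y) (abs_nonneg _)

theorem isQuadratic_mul_abs : IsQuadratic fun x => x * |x| where
  continuous := by fun_prop
  map_mul_sqrt x a ha := by
    rw [abs_mul, abs_of_nonneg (Real.sqrt_nonneg a), mul_mul_mul_comm, Real.mul_self_sqrt ha,
      mul_comm]
  abs_sub_le x y := by
    have h : x * |x| - y * |y| = (x - y) * |x| + y * (|x| - |y|) := by ring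
    rw [h]
    refine (abs_add_le _ _).trans ?_
    rw [abs_mul, abs_mul, abs_abs, mul_add]
    have := mul_le_mul_of_nonneg_left (abs_abs_sub_abs_le x y) (abs_nonneg y)
    linarith

variable {Φ : ℝ → ℝ}

theorem IsQuadratic.map_zero (hΦ : IsQuadratic Φ) : Φ 0 = 0 := by
  simpa using hΦ.map_mul_sqrt 0 0 le_rfl

theorem IsQuadratic.integrable (hΦ : IsQuadratic Φ) {p : ℝ → ℝ} (hp : MemLp p 2 unitMeasure) :
    Integrable (fun t => Φ (p t)) unitMeasure := by
  refine hp.integrable_sq.mono (hΦ.continuous.comp_aestronglyMeasurable hp.1) (ae_of_all _ fun t => ?_)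
  have := hΦ.abs_sub_le (p t) 0
  rw [hΦ.map_zero] at this
  simpa [← pow_two] using this

/-- Integrals of quadratic expressions are continuous in `L²`. -/
theorem IsQuadratic.tendsto_setIntegral (hΦ : IsQuadratic Φ) {p : ℕ → L2} {r : L2}
    (h : Tendsto p atTop (𝓝 r)) (s : Set ℝ) :
    Tendsto (fun n => ∫ t in s, Φ (p n t) ∂unitMeasure) atTop
      (𝓝 (∫ t in s, Φ (r t) ∂unitMeasure)) := by
  refine tendsto_setIntegral_of_L1' (fun t => Φ (r t)) (hΦ.integrable (Lp.memLp r)).1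
    (.of_forall fun n => hΦ.integrable (Lp.memLp (p n))) ?_ s
  have hnorm : Tendsto (fun n => eLpNorm (p n - r : ℝ → ℝ) 2 unitMeasure) atTop (𝓝 0) :=
    (Lp.tendsto_Lp_iff_tendsto_eLpNorm' p r).1 h
  have hsum : Tendsto (fun n => ‖p n‖ₑ + ‖r‖ₑ) atTop (𝓝 (‖r‖ₑ + ‖r‖ₑ)) :=
    h.enorm.add tendsto_const_nhds
  have hprod := ENNReal.Tendsto.mul hnorm (Or.inr (by simp)) hsum (Or.inr (by simp))
  rw [zero_mul] at hprod
  refine tendsto_of_tendsto_of_tendsto_of_le_of_le tendsto_const_nhds hprod (fun _ => zero_le) ?_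
  intro n
  have hp := (Lp.memLp (p n)).1
  have hr := (Lp.memLp r).1
  -- Cauchy–Schwarz on the Lipschitz estimate: the first factor tends to zero, the second stays
  -- bounded.
  calc eLpNorm ((fun t => Φ (p n t)) - fun t => Φ (r t)) 1 unitMeasure
      ≤ eLpNorm ((p n - r : ℝ → ℝ) • fun t => ‖p n t‖ + ‖r t‖) 1 unitMeasure := by
        refine eLpNorm_mono fun t => ?_
        simp only [Pi.sub_apply, Pi.smul_apply', smul_eq_mul, norm_mul, Real.norm_eq_abs]
        rw [abs_of_nonneg (a := |p n t| + |r t|) (by positivity)]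
        exact hΦ.abs_sub_le _ _
    _ ≤ eLpNorm (p n - r : ℝ → ℝ) 2 unitMeasure
          * eLpNorm (fun t => ‖p n t‖ + ‖r t‖) 2 unitMeasure :=
        eLpNorm_smul_le_mul_eLpNorm (hp.norm.add hr.norm) (hp.sub hr)
    _ ≤ eLpNorm (p n - r : ℝ → ℝ) 2 unitMeasure * (‖p n‖ₑ + ‖r‖ₑ) := by
        refine mul_le_mul_right ?_ _
        rw [Lp.enorm_def, Lp.enorm_def]
        refine (eLpNorm_add_le hp.norm hr.norm one_le_two).trans ?_
        rw [eLpNorm_norm, eLpNorm_norm]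

theorem IsQuadratic.ae_map_act (hΦ : IsQuadratic Φ) {γ : ℝ → ℝ} (h : γ ∈ warpings) (q : ℝ → ℝ) :
    ∀ᵐ t ∂unitMeasure, Φ (act q γ t) = deriv γ t * Φ (q (γ t)) := by
  filter_upwards [h.2.2.1] with t ht
  exact hΦ.map_mul_sqrt _ _ ht

/-- Homogeneity turns the factor `√γ'` into the Jacobian `γ'`. -/
theorem IsQuadratic.setIntegral_act (hΦ : IsQuadratic Φ) {γ p q : ℝ → ℝ} (h : γ ∈ warpings)
    (hq : MemLp q 2 unitMeasure) (hp : p =ᵐ[unitMeasure] act q γ) {t : ℝ}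
    (ht : t ∈ Icc (0 : ℝ) 1) :
    ∫ s in Icc 0 t, Φ (p s) ∂unitMeasure = ∫ x in Icc 0 (γ t), Φ (q x) ∂unitMeasure := by
  rw [← setIntegral_comp_mul_deriv h (hΦ.integrable hq) ht]
  refine integral_congr_ae (ae_restrict_of_ae ?_)
  filter_upwards [hp, hΦ.ae_map_act h q] with s h1 h2
  rw [h1, h2]

end Quadratic

/-! ### Primitives and absolute continuity of their inverses -/

section Primitive

variable {φ : ℝ → ℝ}

theorem absolutelyContinuousOnInterval_setIntegral (hφ : Integrable φ unitMeasure) :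
    AbsolutelyContinuousOnInterval (fun t => ∫ s in (0 : ℝ)..t, φ s) 0 1 :=
  (intervalIntegrable_of_integrable hφ).absolutelyContinuousOnInterval_intervalIntegral (by simp)

theorem continuousOn_setIntegral (hφ : Integrable φ unitMeasure) :
    ContinuousOn (fun t => ∫ s in Icc 0 t, φ s ∂unitMeasure) (Icc 0 1) := by
  have := (absolutelyContinuousOnInterval_setIntegral hφ).continuousOn
  rw [uIcc_of_le zero_le_one] at this
  exact this.congr fun t ht => (intervalIntegral_eq_setIntegral_unitMeasure φ ht).symm

theorem setIntegral_Icc_sub (hφ : Integrable φ unitMeasure) {x y : ℝ} (hx : 0 ≤ x) (hxy : x ≤ y) :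
    ∫ s in Icc 0 y, φ s ∂unitMeasure - ∫ s in Icc 0 x, φ s ∂unitMeasure =
      ∫ s in Ioc x y, φ s ∂unitMeasure := by
  rw [← Icc_union_Ioc_eq_Icc hx hxy, setIntegral_union _ measurableSet_Ioc hφ.integrableOn
    hφ.integrableOn, add_sub_cancel_left]
  exact disjoint_left.2 fun t h1 h2 => h2.1.not_ge h1.2

theorem unitMeasure_Ioc {x y : ℝ} (hx : 0 ≤ x) (hy : y ≤ 1) :
    unitMeasure (Ioc x y) = ENNReal.ofReal (y - x) := by
  rw [unitMeasure, Measure.restrict_apply' measurableSet_Icc,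
    inter_eq_left.2 (Ioc_subset_Icc_self.trans (Icc_subset_Icc hx hy)), Real.volume_Ioc]

theorem unitMeasure_uIoc {x y : ℝ} (hx : x ∈ Icc (0 : ℝ) 1) (hy : y ∈ Icc (0 : ℝ) 1) :
    unitMeasure (uIoc x y) = ENNReal.ofReal (dist x y) := by
  rw [uIoc, unitMeasure_Ioc (le_min hx.1 hy.1) (max_le hx.2 hy.2), max_sub_min_eq_abs', Real.dist_eq]

theorem withDensity_uIoc (hφ : Integrable φ unitMeasure) (h0 : 0 ≤ᵐ[unitMeasure] φ) {x y : ℝ}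
    (hx : 0 ≤ x) (hy : 0 ≤ y) :
    unitMeasure.withDensity (fun t => ENNReal.ofReal (φ t)) (uIoc x y) =
      ENNReal.ofReal (dist (∫ s in Icc 0 x, φ s ∂unitMeasure)
        (∫ s in Icc 0 y, φ s ∂unitMeasure)) := by
  wlog hxy : x ≤ y generalizing x y
  · rw [uIoc_comm, dist_comm]
    exact this hy hx (le_of_not_ge hxy)
  rw [dist_comm, Real.dist_eq, setIntegral_Icc_sub hφ hx hxy, uIoc_of_le hxy,
    withDensity_apply _ measurableSet_Ioc, abs_of_nonneg
      (integral_nonneg_of_ae (ae_restrict_of_ae h0)),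
    ofReal_integral_eq_lintegral_ofReal hφ.integrableOn (ae_restrict_of_ae h0)]

theorem strictMonoOn_setIntegral (hφ : Integrable φ unitMeasure)
    (h0 : ∀ᵐ t ∂unitMeasure, 0 < φ t) :
    StrictMonoOn (fun t => ∫ s in Icc 0 t, φ s ∂unitMeasure) (Icc 0 1) := by
  intro x hx y hy hxy
  have h : 0 < ∫ s in Ioc x y, φ s ∂unitMeasure := by
    rw [setIntegral_pos_iff_support_of_nonneg_ae
      (ae_restrict_of_ae (h0.mono fun t ht => ht.le)) hφ.integrableOn]
    have : (Function.support φ ∩ Ioc x y : Set ℝ) =ᵐ[unitMeasure] Ioc x y := by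
      filter_upwards [h0] with t ht
      exact propext ⟨fun h => h.2, fun h => ⟨ht.ne', h⟩⟩
    rw [measure_congr this, unitMeasure_Ioc hx.1 hy.2]
    simpa using hxy
  rw [← setIntegral_Icc_sub hφ hx.1 hxy.le] at h
  exact sub_pos.1 h

theorem monotoneOn_setIntegral (hφ : Integrable φ unitMeasure) (h0 : 0 ≤ᵐ[unitMeasure] φ) :
    MonotoneOn (fun t => ∫ s in Icc 0 t, φ s ∂unitMeasure) (Icc 0 1) := by
  intro x hx y hy hxy
  have h : 0 ≤ ∫ s in Ioc x y, φ s ∂unitMeasure := integral_nonneg_of_ae (ae_restrict_of_ae h0)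
  rw [← setIntegral_Icc_sub hφ hx.1 hxy] at h
  exact sub_nonneg.1 h

theorem disjoint_uIoc_of_monotoneOn {α β : Type*} [LinearOrder α] [LinearOrder β] {f : α → β}
    {S : Set α} (hf : MonotoneOn f S) {a b c d : α} (ha : a ∈ S) (hb : b ∈ S) (hc : c ∈ S)
    (hd : d ∈ S) (h : Disjoint (uIoc a b) (uIoc c d)) :
    Disjoint (uIoc (f a) (f b)) (uIoc (f c) (f d)) := by
  have key : ∀ {x y z w : α}, x ∈ S → y ∈ S → z ∈ S → w ∈ S → ∀ {v : β},
      v ∈ uIoc (f x) (f y) → v ∈ uIoc (f z) (f w) → min x y < max z w := by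
    intro x y z w hx hy hz hw v h1 h2
    rw [uIoc, ← hf.map_min hx hy, ← hf.map_max hx hy] at h1
    rw [uIoc, ← hf.map_min hz hw, ← hf.map_max hz hw] at h2
    refine lt_of_not_ge fun hle => (h1.1.trans_le h2.2).not_ge (hf ?_ ?_ hle)
    · rcases max_choice z w with h | h <;> rw [h] <;> assumption
    · rcases min_choice x y with h | h <;> rw [h] <;> assumption
  refine disjoint_left.2 fun v h1 h2 => ?_
  -- If the images meet, monotonicity puts every left endpoint below every right endpoint, so the
  -- smaller right endpoint is a common point.
  have hmem : min (max a b) (max c d) ∈ uIoc a b ∩ uIoc c d := by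
    refine ⟨⟨?_, min_le_left _ _⟩, ⟨?_, min_le_right _ _⟩⟩
    · exact lt_min (key ha hb ha hb h1 h1) (key ha hb hc hd h1 h2)
    · exact lt_min (key hc hd ha hb h2 h1) (key hc hd hc hd h2 h2)
  exact Set.disjoint_left.1 h hmem.1 hmem.2

/-- If `γ` is monotone and the composition of a primitive of an a.e. positive function with `γ` is
absolutely continuous, then `γ` is absolutely continuous. -/
theorem absolutelyContinuousOnInterval_of_comp_setIntegral (hφ : Integrable φ unitMeasure)
    (h0 : ∀ᵐ t ∂unitMeasure, 0 < φ t) {γ G : ℝ → ℝ} (hm : MonotoneOn γ (Icc 0 1))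
    (hmaps : MapsTo γ (Icc 0 1) (Icc 0 1)) (hG : AbsolutelyContinuousOnInterval G 0 1)
    (hcomp : ∀ t ∈ Icc (0 : ℝ) 1, ∫ s in Icc 0 (γ t), φ s ∂unitMeasure = G t) :
    AbsolutelyContinuousOnInterval γ 0 1 := by
  set ρ := unitMeasure.withDensity fun t => ENNReal.ofReal (φ t)
  have : IsFiniteMeasure ρ := isFiniteMeasure_withDensity_ofReal hφ.2
  have hac : unitMeasure ≪ ρ := withDensity_absolutelyContinuous'
    hφ.1.aemeasurable.ennreal_ofReal (h0.mono fun t ht => by simpa using ht)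
  rw [absolutelyContinuousOnInterval_iff] at hG ⊢
  intro ε hε
  -- Positivity of `φ` makes Lebesgue measure absolutely continuous with respect to `ρ = φ dt`, so
  -- small `ρ`-mass forces small length.
  obtain ⟨η, hη, hη'⟩ := exists_pos_setLIntegral_lt_of_measure_lt
    (Measure.lintegral_rnDeriv_lt_top unitMeasure ρ).ne (ENNReal.ofReal_pos.2 hε).ne'
  obtain ⟨η', hη0, hηη⟩ : ∃ η' : ℝ, 0 < η' ∧ ENNReal.ofReal η' ≤ η := by
    rcases eq_or_ne η ∞ with rfl | hne
    · exact ⟨1, one_pos, le_top⟩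
    · exact ⟨η.toReal, ENNReal.toReal_pos hη.ne' hne, ENNReal.ofReal_toReal_le⟩
  obtain ⟨δ, hδ, hδ'⟩ := hG η' hη0
  refine ⟨δ, hδ, fun E hE hlen => ?_⟩
  have hsum := hδ' E hE hlen
  obtain ⟨hmem, hdisj⟩ := hE
  rw [uIcc_of_le zero_le_one] at hmem
  -- The `ρ`-mass of `U` is at most the total increment of `G`; its length is the total increment of
  -- `γ`.
  set U := ⋃ i ∈ Finset.range E.1, uIoc (γ (E.2 i).1) (γ (E.2 i).2)
  have hρ : ρ U < η := by
    refine lt_of_le_of_lt (measure_biUnion_finset_le _ _)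
      (lt_of_lt_of_le ?_ hηη)
    rw [← ENNReal.ofReal_lt_ofReal_iff hη0, ENNReal.ofReal_sum_of_nonneg fun _ _ => dist_nonneg]
      at hsum
    refine lt_of_eq_of_lt (Finset.sum_congr rfl fun i hi => ?_) hsum
    obtain ⟨h1, h2⟩ := hmem i hi
    rw [withDensity_uIoc hφ (h0.mono fun t ht => ht.le) (hmaps h1).1 (hmaps h2).1, hcomp _ h1,
      hcomp _ h2]
  have hvol := hη' U hρ
  rw [Measure.setLIntegral_rnDeriv hac, measure_biUnion_finset _ fun _ _ => measurableSet_uIoc]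
    at hvol
  · rw [← ENNReal.ofReal_lt_ofReal_iff hε, ENNReal.ofReal_sum_of_nonneg fun _ _ => dist_nonneg]
    refine lt_of_eq_of_lt (Finset.sum_congr rfl fun i hi => ?_) hvol
    obtain ⟨h1, h2⟩ := hmem i hi
    exact (unitMeasure_uIoc (hmaps h1) (hmaps h2)).symm
  · intro i hi j hj hij
    exact disjoint_uIoc_of_monotoneOn hm (hmem i hi).1 (hmem i hi).2 (hmem j hj).1 (hmem j hj).2
      (hdisj hi hj hij)

end Primitive

/-! ### Closedness of the `Γ`-orbit -/

theorem ae_deriv_nonneg_of_monotoneOn {γ : ℝ → ℝ} (h : MonotoneOn γ (Icc 0 1)) :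
    ∀ᵐ t ∂unitMeasure, 0 ≤ deriv γ t := by
  filter_upwards [ae_mem_Ioo] with t ht
  rw [← derivWithin_of_mem_nhds (Icc_mem_nhds ht.1 ht.2)]
  exact h.derivWithin_nonneg

/-- Strict monotonicity transfers order bounds back from the values of `F`; continuity of `F` is not
needed. -/
theorem tendsto_of_tendsto_comp_of_strictMonoOn {F : ℝ → ℝ} {a b : ℝ} (hF : StrictMonoOn F (Icc a b))
    {u : ℕ → ℝ} {x : ℝ} (hu : ∀ n, u n ∈ Icc a b) (hx : x ∈ Icc a b)
    (h : Tendsto (fun n => F (u n)) atTop (𝓝 (F x))) : Tendsto u atTop (𝓝 x) := by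
  refine tendsto_order.2 ⟨fun y hy => ?_, fun y hy => ?_⟩
  · rcases lt_or_ge y a with hya | hya
    · exact .of_forall fun n => hya.trans_le (hu n).1
    · have hy' : y ∈ Icc a b := ⟨hya, hy.le.trans hx.2⟩
      exact (h.eventually_const_lt (hF hy' hx hy)).mono fun n hn => (hF.lt_iff_lt hy' (hu n)).1 hn
  · rcases lt_or_ge b y with hya | hya
    · exact .of_forall fun n => (hu n).2.trans_lt hya
    · have hy' : y ∈ Icc a b := ⟨hx.1.trans hy.le, hya⟩
      exact (h.eventually_lt_const (hF hx hy' hy)).mono fun n hn => (hF.lt_iff_lt (hu n) hy').1 hn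

theorem isClosed_orbit_warpings {q : ℝ → ℝ} (hq : MemLp q 2 unitMeasure)
    (hq0 : ∀ᵐ t ∂unitMeasure, q t ≠ 0) : IsClosed (orbit warpings q) := by
  refine isClosed_of_closure_subset fun r hr => ?_
  obtain ⟨p, hp, hlim⟩ := mem_closure_iff_seq_limit.1 hr
  choose γ hγ hpγ using hp
  have hr2 := Lp.memLp r
  set F : ℝ → ℝ := fun x => ∫ s in Icc 0 x, q s ^ 2 ∂unitMeasure with hFdef
  set G : ℝ → ℝ := fun t => ∫ s in Icc 0 t, r s ^ 2 ∂unitMeasure with hGdef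
  have hqpos : ∀ᵐ t ∂unitMeasure, 0 < q t ^ 2 := hq0.mono fun t ht => by positivity
  have hFs : StrictMonoOn F (Icc 0 1) := strictMonoOn_setIntegral hq.integrable_sq hqpos
  have hFc : ContinuousOn F (Icc 0 1) := continuousOn_setIntegral hq.integrable_sq
  have hGm : MonotoneOn G (Icc 0 1) :=
    monotoneOn_setIntegral hr2.integrable_sq (ae_of_all _ fun t => sq_nonneg _)
  have hconv : ∀ t ∈ Icc (0 : ℝ) 1, Tendsto (fun n => F (γ n t)) atTop (𝓝 (G t)) := by
    intro t ht
    refine (isQuadratic_sq.tendsto_setIntegral hlim (Icc 0 t)).congr fun n => ?_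
    exact isQuadratic_sq.setIntegral_act (hγ n) hq (hpγ n) ht
  have hmem0 : (0 : ℝ) ∈ Icc (0 : ℝ) 1 := by simp
  have hmem1 : (1 : ℝ) ∈ Icc (0 : ℝ) 1 := by simp
  -- All `γ n` fix the endpoints, so the convergent sequences are constant there.
  have hG0 : F 0 = G 0 := tendsto_nhds_unique
    (by simp [(hγ _).2.2.2.1]) (hconv 0 hmem0)
  have hG1 : F 1 = G 1 := tendsto_nhds_unique
    (by simp [(hγ _).2.2.2.2]) (hconv 1 hmem1)
  have hex : ∀ t, ∃ x, t ∈ Icc (0 : ℝ) 1 → x ∈ Icc (0 : ℝ) 1 ∧ F x = G t := by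
    intro t
    by_cases ht : t ∈ Icc (0 : ℝ) 1
    · obtain ⟨x, hx, hx'⟩ := intermediate_value_Icc zero_le_one hFc
        (show G t ∈ Icc (F 0) (F 1) from
          ⟨hG0.trans_le (hGm hmem0 ht ht.1), (hGm ht hmem1 ht.2).trans_eq hG1.symm⟩)
      exact ⟨x, fun _ => ⟨hx, hx'⟩⟩
    · exact ⟨0, fun h => absurd h ht⟩
  choose δ hδ using hex
  have hmaps : MapsTo δ (Icc 0 1) (Icc 0 1) := fun t ht => (hδ t ht).1
  have hFδ : ∀ t ∈ Icc (0 : ℝ) 1, F (δ t) = G t := fun t ht => (hδ t ht).2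
  have hδm : MonotoneOn δ (Icc 0 1) := fun s hs t ht hst =>
    (hFs.le_iff_le (hmaps hs) (hmaps ht)).1 (by rw [hFδ s hs, hFδ t ht]; exact hGm hs ht hst)
  have hδw : δ ∈ warpings := by
    refine ⟨hmaps, ?_, ae_deriv_nonneg_of_monotoneOn hδm, ?_, ?_⟩
    · refine absolutelyContinuousOnInterval_of_comp_setIntegral hq.integrable_sq hqpos hδm hmaps
        (absolutelyContinuousOnInterval_setIntegral hr2.integrable_sq) fun t ht => ?_
      rw [intervalIntegral_eq_setIntegral_unitMeasure _ ht]
      exact hFδ t ht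
    · exact hFs.injOn (hmaps hmem0) hmem0 ((hFδ 0 hmem0).trans hG0.symm)
    · exact hFs.injOn (hmaps hmem1) hmem1 ((hFδ 1 hmem1).trans hG1.symm)
  refine ⟨δ, hδw, ?_⟩
  have hΨ := isQuadratic_mul_abs
  have hae : (fun t => r t * |r t|) =ᵐ[unitMeasure] fun t => act q δ t * |act q δ t| := by
    refine ae_eq_of_forall_setIntegral_Icc_eq (hΨ.integrable hr2)
      (hΨ.integrable (memLp_act hδw hq)) fun t ht => ?_
    rw [hΨ.setIntegral_act hδw hq (ae_eq_refl _) ht]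
    -- Pointwise convergence of the warpings, obtained from squares, identifies the limit of the
    -- signed integrals.
    have hγt : Tendsto (fun n => γ n t) atTop (𝓝 (δ t)) :=
      tendsto_of_tendsto_comp_of_strictMonoOn hFs (fun n => (hγ n).1 ht) (hmaps ht)
        ((hFδ t ht).symm ▸ hconv t ht)
    have h1 := (continuousOn_setIntegral (hΨ.integrable hq) (δ t) (hmaps ht)).tendsto.comp
      (tendsto_nhdsWithin_iff.2 ⟨hγt, .of_forall fun n => (hγ n).1 ht⟩)
    refine tendsto_nhds_unique (hΨ.tendsto_setIntegral hlim (Icc 0 t)) (h1.congr fun n => ?_)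
    exact (hΨ.setIntegral_act (hγ n) hq (hpγ n) ht).symm
  filter_upwards [hae] with t ht
  have hinj : Function.Injective fun x : ℝ => x * |x| := by
    intro x y hxy
    simp only at hxy
    rcases abs_cases x with ⟨h1, h1'⟩ | ⟨h1, h1'⟩ <;> rcases abs_cases y with ⟨h2, h2'⟩ | ⟨h2, h2'⟩ <;>
      rw [h1, h2] at hxy <;> nlinarith
  exact hinj ht

end Warp

theorem corollary4p10 (q : ℝ → ℝ) (hq : MeasureTheory.MemLp q 2 Warp.unitMeasure)
    (hq0 : ∀ᵐ t ∂Warp.unitMeasure, q t ≠ 0) :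
    closure (Warp.orbit Warp.invertibleWarpings q) = Warp.orbit Warp.warpings q := by
  refine Set.Subset.antisymm ?_ (Warp.orbit_warpings_subset_closure hq)
  refine closure_minimal ?_ (Warp.isClosed_orbit_warpings hq hq0)
  rintro p ⟨γ, hγ, hp⟩
  exact ⟨γ, hγ.1, hp⟩
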